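/- Let $n\ge 0$ be an integer, let $P_1\in\mathbb C^{n\times n}$ be invertible and Hermitian, let $P_0\in\mathbb C^{n\times n}$ and let $\tilde W_B\in\mathbb C^{n\times 2n}$. On $X_2:=L^2(0,1;\mathbb C^n)$ consider the operator $$Ax:=P_1\frac{dx}{d\zeta}+P_0x,\qquad D(A):=\Big\{x\in W^{1,2}(0,1;\mathbb C^n)\ \Big|\ \tilde W_B\begin{bmatrix}x(1)\\x(0)\end{bmatrix}=0\Big\}.$$ A Hamiltonian density is a function $\mathcal H$ on $(0,1)$ with values in $\mathbb C^{n\times n}$ such that $\mathcal H(\zeta)$ is a positive definite Hermitian matrix for a.e. $\zeta\in(0,1)$ and $\mathcal H,\mathcal H^{-1}\in L^\infty(0,1;\mathbb C^{n\times n})$. Let $A\mathcal H$ be the operator $x\mapsto A(\mathcal Hx)$ with domain $D(A\mathcal H):=\{x\in X_2\mid \mathcal Hx\in D(A)\}$. Then for every Hamiltonian density $\mathcal H$ the following statements are equivalent: 1. $A$ generates a contraction semigroup (that is, $A$ is the infinitesimal generator of a $C_0$-semigroup $(T(t))_{t\ge0}$ with $\|T(t)\|\le1$ for all $t\ge 0$)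 on $X_2$ with the standard inner product $\langle\cdot,\cdot\rangle$; 2. $A\mathcal H$ generates a contraction semigroup on $X_2$ with the energy inner product $\langle\cdot,\mathcal H\,\cdot\rangle$. Consequently, for any two Hamiltonian densities $\mathcal H_1,\mathcal H_2$, the operator $A\mathcal H_1$ generates a contraction semigroup on $(X_2,\langle\cdot,\mathcal H_1\,\cdot\rangle)$ if and only if $A\mathcal H_2$ generates a contraction semigroup on $(X_2,\langle\cdot,\mathcal H_2\,\cdot\rangle)$. -/

import Mathlib

open MeasureTheory Set Filter Topology
open scoped NNReal ENNReal ContDiff ComplexOrder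

noncomputable section

/-! ## Contraction semigroups and their generators -/

section Semigroup

variable {E : Type*} [NormedAddCommGroup E] [NormedSpace ℂ E]

/-- `T` is a strongly continuous semigroup (a `C₀`-semigroup) of contractions on `E`. -/
structure IsContractionSemigroup (T : ℝ≥0 → E →L[ℂ] E) : Prop where
  map_zero : T 0 = ContinuousLinearMap.id ℂ E
  map_add : ∀ s t : ℝ≥0, T (s + t) = (T s).comp (T t)
  strongly_continuous : ∀ x : E, Tendsto (fun t : ℝ≥0 => T t x) (𝓝[>] 0) (𝓝 x)
  norm_le_one : ∀ t : ℝ≥0, ‖T t‖ ≤ 1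

/-- `A` is the infinitesimal generator of `T`: `x` lies in the domain of `A` and `A x = y` if and
only if the difference quotients `(T t x - x) / t` converge to `y` as `t` decreases to `0`. -/
def IsInfinitesimalGenerator (A : E →ₗ.[ℂ] E) (T : ℝ≥0 → E →L[ℂ] E) : Prop :=
  ∀ x y : E, (x, y) ∈ A.graph ↔
    Tendsto (fun t : ℝ≥0 => (((t : ℝ) : ℂ))⁻¹ • (T t x - x)) (𝓝[>] 0) (𝓝 y)

/-- The unbounded operator `A` generates a contraction semigroup on the normed space `E`. -/
def GeneratesContractionSemigroup (A : E →ₗ.[ℂ] E) : Prop :=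
  ∃ T : ℝ≥0 → E →L[ℂ] E, IsContractionSemigroup T ∧ IsInfinitesimalGenerator A T

end Semigroup

namespace PortHamiltonian

/-! ## The space `L²(0,1; ℂⁿ)` and multiplication by bounded matrix functions -/

/-- Lebesgue measure on the interval `(0,1)`. -/
abbrev μ₀₁ : Measure ℝ := volume.restrict (Ioo (0 : ℝ) 1)

/-- The Hilbert space `X₂ = L²(0,1; ℂⁿ)` with its standard inner product. -/
abbrev X₂ (n : ℕ) : Type := Lp (EuclideanSpace ℂ (Fin n)) 2 μ₀₁

variable {n : ℕ}

/-- The matrix function `M` belongs to `L^∞(0,1; ℂ^{n×n})`. -/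
def EssBounded (M : ℝ → Matrix (Fin n) (Fin n) ℂ) : Prop :=
  ∀ i j, MemLp (fun ζ => M ζ i j) ∞ μ₀₁

theorem essBounded_const (P : Matrix (Fin n) (Fin n) ℂ) : EssBounded (fun _ => P) :=
  fun i j => memLp_const (P i j)

theorem EssBounded.memLp_mulVec {M : ℝ → Matrix (Fin n) (Fin n) ℂ} (hM : EssBounded M)
    (x : X₂ n) :
    MemLp (fun ζ => WithLp.toLp 2 ((M ζ).mulVec (x ζ).ofLp) : ℝ → EuclideanSpace ℂ (Fin n))
      2 μ₀₁ := by
  refine MemLp.of_eval_piLp fun i => ?_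
  have h : ∀ j ∈ Finset.univ, MemLp (fun ζ => M ζ i j * (x ζ) j) 2 μ₀₁ := fun j _ =>
    MemLp.mul' (p := ∞) (q := 2) (r := 2) ((Lp.memLp x).eval_piLp j) (hM i j)
  exact memLp_finsetSum Finset.univ h

/-- Multiplication by an essentially bounded matrix function, `(M x)(ζ) = M(ζ) x(ζ)`. -/
def matMul (M : ℝ → Matrix (Fin n) (Fin n) ℂ) (hM : EssBounded M) : X₂ n →ₗ[ℂ] X₂ n where
  toFun x := (hM.memLp_mulVec x).toLp
  map_add' x y := by
    rw [← MemLp.toLp_add]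
    refine MemLp.toLp_congr _ _ ?_
    filter_upwards [Lp.coeFn_add x y] with ζ h
    rw [Pi.add_apply, h, Pi.add_apply, WithLp.ofLp_add, Matrix.mulVec_add, WithLp.toLp_add]
  map_smul' c x := by
    refine Eq.trans ?_ (MemLp.toLp_const_smul c (hM.memLp_mulVec x))
    refine MemLp.toLp_congr _ ((hM.memLp_mulVec x).const_smul c) ?_
    filter_upwards [Lp.coeFn_smul c x] with ζ h
    rw [Pi.smul_apply, h, Pi.smul_apply, WithLp.ofLp_smul, Matrix.mulVec_smul, WithLp.toLp_smul]

theorem matMul_coeFn (M : ℝ → Matrix (Fin n) (Fin n) ℂ) (hM : EssBounded M) (x : X₂ n) :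
    matMul M hM x =ᵐ[μ₀₁] fun ζ => WithLp.toLp 2 ((M ζ).mulVec (x ζ).ofLp) :=
  MemLp.coeFn_toLp (hM.memLp_mulVec x)

/-! ## The Sobolev space `W^{1,2}(0,1; ℂⁿ)` -/

/-- `g` is the weak derivative of `f` on `(0,1)`. -/
def HasWeakDeriv (f g : X₂ n) : Prop :=
  ∀ φ : ℝ → ℝ, ContDiff ℝ ∞ φ → HasCompactSupport φ → tsupport φ ⊆ Ioo 0 1 →
    ∫ ζ in Ioo (0 : ℝ) 1, deriv φ ζ • f ζ = -∫ ζ in Ioo (0 : ℝ) 1, φ ζ • g ζ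

theorem integrable_smul {φ : ℝ → ℝ} (hφ : Continuous φ) (hc : HasCompactSupport φ) (f : X₂ n) :
    Integrable (fun ζ => φ ζ • f ζ) μ₀₁ := by
  have hf : Integrable f μ₀₁ := (Lp.memLp f).integrable (by norm_num)
  obtain ⟨C, hC⟩ := hc.exists_bound_of_continuous hφ
  exact hf.bdd_smul C hφ.aestronglyMeasurable (Eventually.of_forall hC)

theorem HasWeakDeriv.add {f g f' g' : X₂ n} (h : HasWeakDeriv f g) (h' : HasWeakDeriv f' g') :
    HasWeakDeriv (f + f') (g + g') := by
  intro φ hφ hc hs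
  have e1 : ∫ ζ in Ioo (0 : ℝ) 1, deriv φ ζ • (f + f') ζ
      = ∫ ζ in Ioo (0 : ℝ) 1, (deriv φ ζ • f ζ + deriv φ ζ • f' ζ) := by
    refine integral_congr_ae ?_
    filter_upwards [Lp.coeFn_add f f'] with ζ hζ
    rw [hζ, Pi.add_apply, smul_add]
  have e2 : ∫ ζ in Ioo (0 : ℝ) 1, φ ζ • (g + g') ζ
      = ∫ ζ in Ioo (0 : ℝ) 1, (φ ζ • g ζ + φ ζ • g' ζ) := by
    refine integral_congr_ae ?_
    filter_upwards [Lp.coeFn_add g g'] with ζ hζ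
    rw [hζ, Pi.add_apply, smul_add]
  have hd : Continuous (deriv φ) := hφ.continuous_deriv (by simp)
  rw [e1, e2, integral_add (integrable_smul hd hc.deriv f) (integrable_smul hd hc.deriv f'),
    integral_add (integrable_smul hφ.continuous hc g) (integrable_smul hφ.continuous hc g'),
    h φ hφ hc hs, h' φ hφ hc hs, neg_add]

theorem HasWeakDeriv.smul {f g : X₂ n} (c : ℂ) (h : HasWeakDeriv f g) :
    HasWeakDeriv (c • f) (c • g) := by
  intro φ hφ hc hs
  have e1 : ∫ ζ in Ioo (0 : ℝ) 1, deriv φ ζ • (c • f) ζ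
      = ∫ ζ in Ioo (0 : ℝ) 1, c • (deriv φ ζ • f ζ) := by
    refine integral_congr_ae ?_
    filter_upwards [Lp.coeFn_smul c f] with ζ hζ
    simp only [hζ, Pi.smul_apply]
    exact smul_comm _ _ _
  have e2 : ∫ ζ in Ioo (0 : ℝ) 1, φ ζ • (c • g) ζ
      = ∫ ζ in Ioo (0 : ℝ) 1, c • (φ ζ • g ζ) := by
    refine integral_congr_ae ?_
    filter_upwards [Lp.coeFn_smul c g] with ζ hζ
    simp only [hζ, Pi.smul_apply]
    exact smul_comm _ _ _
  rw [e1, e2, integral_smul, integral_smul, h φ hφ hc hs, smul_neg]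

theorem hasWeakDeriv_zero : HasWeakDeriv (0 : X₂ n) 0 := by
  intro φ hφ hc hs
  have e : ∀ ψ : ℝ → ℝ, ∫ ζ in Ioo (0 : ℝ) 1, ψ ζ • (0 : X₂ n) ζ = 0 := by
    intro ψ
    refine integral_eq_zero_of_ae ?_
    filter_upwards [Lp.coeFn_zero (EuclideanSpace ℂ (Fin n)) 2 μ₀₁] with ζ hζ
    rw [hζ, Pi.zero_apply, smul_zero]
  rw [e, e, neg_zero]

/-- Weak derivatives are unique. -/
theorem HasWeakDeriv.unique {f g g' : X₂ n} (h : HasWeakDeriv f g) (h' : HasWeakDeriv f g') :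
    g = g' := by
  have hd : Integrable (g - g' : X₂ n) μ₀₁ := (Lp.memLp (g - g')).integrable (by norm_num)
  have key : ∀ᵐ ζ ∂(volume : Measure ℝ), ζ ∈ Ioo (0 : ℝ) 1 → (g - g' : X₂ n) ζ = 0 := by
    refine isOpen_Ioo.ae_eq_zero_of_integral_contDiff_smul_eq_zero
      (IntegrableOn.locallyIntegrableOn hd) ?_
    intro φ hφ hc hs
    have hout : ∀ ζ, ζ ∉ Ioo (0 : ℝ) 1 → φ ζ • (g - g' : X₂ n) ζ = 0 := by
      intro ζ hζ
      rw [image_eq_zero_of_notMem_tsupport (fun hm => hζ (hs hm)), zero_smul]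
    rw [← setIntegral_eq_integral_of_forall_compl_eq_zero hout]
    have e : ∫ ζ in Ioo (0 : ℝ) 1, φ ζ • (g - g' : X₂ n) ζ
        = ∫ ζ in Ioo (0 : ℝ) 1, (φ ζ • g ζ - φ ζ • g' ζ) := by
      refine integral_congr_ae ?_
      filter_upwards [Lp.coeFn_sub g g'] with ζ hζ
      rw [hζ, Pi.sub_apply, smul_sub]
    rw [e, integral_sub (integrable_smul hφ.continuous hc g)
      (integrable_smul hφ.continuous hc g'), sub_eq_zero]
    exact neg_injective ((h φ hφ hc hs).symm.trans (h' φ hφ hc hs))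
  rw [← sub_eq_zero]
  refine (Lp.eq_zero_iff_ae_eq_zero).2 ?_
  exact (ae_restrict_iff' measurableSet_Ioo).2 key

/-- The Sobolev space `W^{1,2}(0,1; ℂⁿ)`, as a subspace of `L²(0,1; ℂⁿ)`. -/
def sobolev (n : ℕ) : Submodule ℂ (X₂ n) where
  carrier := {x | ∃ g : X₂ n, HasWeakDeriv x g}
  add_mem' := fun ⟨g, h⟩ ⟨g', h'⟩ => ⟨g + g', h.add h'⟩
  zero_mem' := ⟨0, hasWeakDeriv_zero⟩
  smul_mem' := fun c _ ⟨g, h⟩ => ⟨c • g, h.smul c⟩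

/-- The weak derivative `d/dζ : W^{1,2}(0,1; ℂⁿ) → L²(0,1; ℂⁿ)`. -/
def weakDeriv (n : ℕ) : sobolev n →ₗ[ℂ] X₂ n where
  toFun x := x.2.choose
  map_add' x y := (x + y).2.choose_spec.unique (x.2.choose_spec.add y.2.choose_spec)
  map_smul' c x := (c • x).2.choose_spec.unique (x.2.choose_spec.smul c)

theorem hasWeakDeriv_weakDeriv (x : sobolev n) : HasWeakDeriv (x : X₂ n) (weakDeriv n x) :=
  x.2.choose_spec

/-- The continuous representative on `[0,1]` of `x` takes the value `a` at `1` and `b` at `0`. -/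
def HasBoundaryValues (x : X₂ n) (a b : Fin n → ℂ) : Prop :=
  ∃ u : ℝ → EuclideanSpace ℂ (Fin n), ContinuousOn u (Icc 0 1) ∧ x =ᵐ[μ₀₁] u ∧
    (u 1).ofLp = a ∧ (u 0).ofLp = b

/-! ## The operator `A` -/

/-- The domain of `A`: those `x ∈ W^{1,2}(0,1; ℂⁿ)` whose boundary values satisfy
`W_B [x(1); x(0)] = 0`. -/
def domainA (WB : Matrix (Fin n) (Fin n ⊕ Fin n) ℂ) : Submodule ℂ (X₂ n) where
  carrier := {x | x ∈ sobolev n ∧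
    ∃ a b : Fin n → ℂ, HasBoundaryValues x a b ∧ WB.mulVec (Sum.elim a b) = 0}
  add_mem' := by
    rintro x y ⟨hx, a, b, ⟨u, hu, hxu, rfl, rfl⟩, hW⟩ ⟨hy, a', b', ⟨v, hv, hyv, rfl, rfl⟩, hW'⟩
    refine ⟨add_mem hx hy, _, _, ⟨u + v, hu.add hv, ?_, rfl, rfl⟩, ?_⟩
    · filter_upwards [Lp.coeFn_add x y, hxu, hyv] with ζ h1 h2 h3
      rw [h1, Pi.add_apply, h2, h3, Pi.add_apply]
    · have e : Sum.elim ((u + v) 1).ofLp ((u + v) 0).ofLp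
          = Sum.elim (u 1).ofLp (u 0).ofLp + Sum.elim (v 1).ofLp (v 0).ofLp := by
        ext i; cases i <;> simp
      rw [e, Matrix.mulVec_add, hW, hW', add_zero]
  zero_mem' := by
    refine ⟨zero_mem _, 0, 0, ⟨0, continuousOn_const, Lp.coeFn_zero _ _ _, rfl, rfl⟩, ?_⟩
    have e : Sum.elim (0 : Fin n → ℂ) (0 : Fin n → ℂ) = 0 := by
      ext i; cases i <;> simp
    rw [e, Matrix.mulVec_zero]
  smul_mem' := by
    rintro c x ⟨hx, a, b, ⟨u, hu, hxu, rfl, rfl⟩, hW⟩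
    refine ⟨Submodule.smul_mem _ c hx, _, _, ⟨c • u, hu.const_smul c, ?_, rfl, rfl⟩, ?_⟩
    · filter_upwards [Lp.coeFn_smul c x, hxu] with ζ h1 h2
      rw [h1, Pi.smul_apply, h2, Pi.smul_apply]
    · have e : Sum.elim ((c • u) 1).ofLp ((c • u) 0).ofLp
          = c • Sum.elim (u 1).ofLp (u 0).ofLp := by
        ext i; cases i <;> simp
      rw [e, Matrix.mulVec_smul, hW, smul_zero]

theorem domainA_le_sobolev (WB : Matrix (Fin n) (Fin n ⊕ Fin n) ℂ) : domainA WB ≤ sobolev n :=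
  fun _ hx => hx.1

/-- The operator `A x = P₁ x' + P₀ x` with domain `domainA WB`. -/
def opA (P₁ P₀ : Matrix (Fin n) (Fin n) ℂ) (WB : Matrix (Fin n) (Fin n ⊕ Fin n) ℂ) :
    X₂ n →ₗ.[ℂ] X₂ n where
  domain := domainA WB
  toFun :=
    matMul (fun _ => P₁) (essBounded_const P₁) ∘ₗ weakDeriv n ∘ₗ
        Submodule.inclusion (domainA_le_sobolev WB)
      + matMul (fun _ => P₀) (essBounded_const P₀) ∘ₗ (domainA WB).subtype

/-! ## Hamiltonian densities, the energy space and the operator `A ℋ` -/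

/-- A Hamiltonian density: a matrix function `ℋ` on `(0,1)` such that `ℋ(ζ)` is a positive
(definite) Hermitian matrix for almost every `ζ` and `ℋ, ℋ⁻¹ ∈ L^∞(0,1; ℂ^{n×n})`. -/
structure HamiltonianDensity (n : ℕ) where
  toFun : ℝ → Matrix (Fin n) (Fin n) ℂ
  posDef : ∀ᵐ ζ ∂μ₀₁, (toFun ζ).PosDef
  essBounded : EssBounded toFun
  essBounded_inv : EssBounded fun ζ => (toFun ζ)⁻¹

/-- Multiplication by `ℋ` on `L²(0,1; ℂⁿ)`. -/
def HamiltonianDensity.mul (H : HamiltonianDensity n) : X₂ n →ₗ[ℂ] X₂ n :=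
  matMul H.toFun H.essBounded

theorem inner_matMul (M : ℝ → Matrix (Fin n) (Fin n) ℂ) (hM : EssBounded M) (x y : X₂ n) :
    inner ℂ x (matMul M hM y)
      = ∫ ζ in Ioo (0 : ℝ) 1, star (x ζ).ofLp ⬝ᵥ (M ζ).mulVec (y ζ).ofLp := by
  rw [L2.inner_def]
  refine integral_congr_ae ?_
  filter_upwards [matMul_coeFn M hM y] with ζ hζ
  rw [hζ, EuclideanSpace.inner_eq_star_dotProduct, dotProduct_comm]

theorem HamiltonianDensity.integrable_energy (H : HamiltonianDensity n) (x : X₂ n) :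
    Integrable (fun ζ => star (x ζ).ofLp ⬝ᵥ (H.toFun ζ).mulVec (x ζ).ofLp) μ₀₁ := by
  refine (L2.integrable_inner (𝕜 := ℂ) x (H.mul x)).congr ?_
  filter_upwards [matMul_coeFn H.toFun H.essBounded x] with ζ hζ
  rw [HamiltonianDensity.mul, hζ, EuclideanSpace.inner_eq_star_dotProduct, dotProduct_comm]

theorem HamiltonianDensity.conj_inner (H : HamiltonianDensity n) (x y : X₂ n) :
    (starRingEnd ℂ) (inner ℂ y (H.mul x)) = inner ℂ x (H.mul y) := by
  rw [HamiltonianDensity.mul, inner_matMul, inner_matMul, ← integral_conj]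
  refine integral_congr_ae ?_
  filter_upwards [H.posDef] with ζ hζ
  have h := hζ.isHermitian
  rw [starRingEnd_apply, Matrix.star_dotProduct, star_star, Matrix.star_mulVec, h.eq,
    ← Matrix.dotProduct_mulVec]

theorem HamiltonianDensity.re_inner_eq (H : HamiltonianDensity n) (x : X₂ n) :
    RCLike.re (inner ℂ x (H.mul x))
      = ∫ ζ in Ioo (0 : ℝ) 1,
          RCLike.re (star (x ζ).ofLp ⬝ᵥ (H.toFun ζ).mulVec (x ζ).ofLp) := by
  rw [HamiltonianDensity.mul, inner_matMul]
  exact (integral_re (H.integrable_energy x)).symm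

theorem HamiltonianDensity.re_energy_nonneg (H : HamiltonianDensity n) (x : X₂ n) :
    ∀ᵐ ζ ∂μ₀₁, 0 ≤ RCLike.re (star (x ζ).ofLp ⬝ᵥ (H.toFun ζ).mulVec (x ζ).ofLp) := by
  filter_upwards [H.posDef] with ζ hζ
  exact (RCLike.nonneg_iff.1 (hζ.posSemidef.dotProduct_mulVec_nonneg (x ζ).ofLp)).1

/-- The vector space `L²(0,1; ℂⁿ)` equipped with the energy inner product `⟨·, ℋ ·⟩`. -/
def EnergySpace (_H : HamiltonianDensity n) : Type := X₂ n

namespace EnergySpace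

variable (H : HamiltonianDensity n)

instance : AddCommGroup (EnergySpace H) := inferInstanceAs (AddCommGroup (X₂ n))

instance : Module ℂ (EnergySpace H) := inferInstanceAs (Module ℂ (X₂ n))

/-- The identification (of vector spaces) of the energy space with `L²(0,1; ℂⁿ)`. -/
def toL2 : EnergySpace H ≃ₗ[ℂ] X₂ n := LinearEquiv.refl ℂ (X₂ n)

/-- The energy inner product `⟨x, ℋ y⟩`. -/
@[reducible] def core : InnerProductSpace.Core ℂ (EnergySpace H) where
  inner x y := inner ℂ (toL2 H x) (H.mul (toL2 H y))
  conj_inner_symm x y := H.conj_inner (toL2 H x) (toL2 H y)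
  re_inner_nonneg x := by
    rw [H.re_inner_eq]
    exact integral_nonneg_of_ae (H.re_energy_nonneg _)
  add_left x y z := by rw [map_add, inner_add_left]
  smul_left x y r := by rw [map_smul, inner_smul_left]
  definite x hx := by
    have h0 := congrArg RCLike.re hx
    rw [H.re_inner_eq, map_zero, integral_eq_zero_iff_of_nonneg_ae (H.re_energy_nonneg _)
      (H.integrable_energy _).re] at h0
    refine (toL2 H).map_eq_zero_iff.1 ((Lp.eq_zero_iff_ae_eq_zero).2 ?_)
    filter_upwards [h0, H.posDef] with ζ h1 h2
    by_contra hne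
    have hne' : (toL2 H x ζ).ofLp ≠ 0 := fun h => hne (by
      ext i
      simpa using congrFun h i)
    exact (RCLike.pos_iff.1 (h2.dotProduct_mulVec_pos hne')).1.ne' h1

instance : NormedAddCommGroup (EnergySpace H) := (core H).toNormedAddCommGroup

instance : InnerProductSpace ℂ (EnergySpace H) := InnerProductSpace.ofCore (core H).toCore

theorem inner_def (x y : EnergySpace H) :
    inner ℂ x y = inner ℂ (toL2 H x) (H.mul (toL2 H y)) := rfl

end EnergySpace

/-- The operator `A ℋ` on the energy space, with domain `{x | ℋ x ∈ D(A)}`. -/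
def opAH (P₁ P₀ : Matrix (Fin n) (Fin n) ℂ) (WB : Matrix (Fin n) (Fin n ⊕ Fin n) ℂ)
    (H : HamiltonianDensity n) : EnergySpace H →ₗ.[ℂ] EnergySpace H where
  domain := (opA P₁ P₀ WB).domain.comap (H.mul ∘ₗ (EnergySpace.toL2 H).toLinearMap)
  toFun := (EnergySpace.toL2 H).symm.toLinearMap ∘ₗ (opA P₁ P₀ WB).toFun ∘ₗ
    (H.mul ∘ₗ (EnergySpace.toL2 H).toLinearMap).restrict (fun _ hx => hx)

end PortHamiltonian

end

/-! By the Lumer–Phillips theorem on a Hilbert space, generating a contraction semigroup amounts to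
being m-dissipative: `Re ⟨x, A x⟩ ≤ 0` on the domain, and `1 - A` onto. It remains to move these two
conditions between `A` and `A ℋ`.

Dissipativity transfers at once: with `w = ℋ x`, the energy pairing `⟨x, A ℋ x⟩_ℋ` equals the
standard pairing `⟨w, A w⟩`.

The range condition needs an argument, since `x - A ℋ x = y` becomes `ℋ⁻¹ w - A w = y`, with `ℋ⁻¹`
in place of the identity. Now `ℋ⁻¹` is bounded and coercive, and for m-dissipative `A` every bounded
coercive `C` makes `C - A` onto (`exists_apply_sub_eq_of_coercive`): for large `r` the operator `C`
is within distance less than `r` of `r`, and `r - A` has an inverse of norm at most `1/r`, so a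
fixed point argument applies. The converse is the same argument on the energy space with `C = ℋ`.

Lumer–Phillips itself is proved by Yosida approximation in one direction and by the Laplace
transform of the semigroup in the other. -/

noncomputable section

/-! ## m-dissipative operators on Hilbert spaces -/

section MDissipative

variable {E : Type*} [NormedAddCommGroup E] [InnerProductSpace ℂ E]

/-- `A` is dissipative and `1 - A` is surjective. -/
structure IsMDissipative (A : E →ₗ.[ℂ] E) : Prop where
  re_inner_nonpos : ∀ x z : E, (x, z) ∈ A.graph → RCLike.re (inner ℂ x z) ≤ 0
  exists_sub_eq : ∀ y : E, ∃ x z : E, (x, z) ∈ A.graph ∧ x - z = y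

/-- `R` is the inverse of `r - A`. -/
structure IsRealResolvent (A : E →ₗ.[ℂ] E) (r : ℝ) (R : E →L[ℂ] E) : Prop where
  mem_graph : ∀ y : E, (R y, r • R y - y) ∈ A.graph
  apply_sub : ∀ x z : E, (x, z) ∈ A.graph → R (r • x - z) = x
  norm_apply_le : ∀ y : E, r * ‖R y‖ ≤ ‖y‖

namespace IsMDissipative

variable {A : E →ₗ.[ℂ] E}

/-- Dissipativity gives `r ‖x‖² ≤ Re ⟨x, r x - z⟩`; apply Cauchy–Schwarz and cancel `‖x‖`. -/
theorem mul_norm_le (hA : IsMDissipative A) (r : ℝ) {x z : E} (h : (x, z) ∈ A.graph) :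
    r * ‖x‖ ≤ ‖r • x - z‖ := by
  have h1 := hA.re_inner_nonpos x z h
  have h2 : RCLike.re (inner ℂ x (r • x - z)) = r * ‖x‖ ^ 2 - RCLike.re (inner ℂ x z) := by
    rw [inner_sub_right, map_sub, inner_smul_right_eq_smul, RCLike.smul_re,
      ← inner_self_eq_norm_sq (𝕜 := ℂ)]
  have h3 := re_inner_le_norm (𝕜 := ℂ) x (r • x - z)
  rcases (norm_nonneg x).eq_or_lt with h0 | h0
  · rw [← h0, mul_zero]
    exact norm_nonneg _
  · refine le_of_mul_le_mul_left ?_ h0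
    nlinarith

/-- The lower bound `mul_norm_le` makes solutions of `r x - A x = y` unique, so any choice of
solutions is automatically linear, and bounded by `1/r`. -/
theorem exists_realResolvent (hA : IsMDissipative A) {r : ℝ} (hr : 0 < r)
    (hs : ∀ y : E, ∃ x z : E, (x, z) ∈ A.graph ∧ r • x - z = y) :
    ∃ R : E →L[ℂ] E, IsRealResolvent A r R := by
  have inj : ∀ {x z x' z' : E}, (x, z) ∈ A.graph → (x', z') ∈ A.graph →
      r • x - z = r • x' - z' → x = x' := by
    intro x z x' z' h h' e
    have h1 := hA.mul_norm_le r (A.graph.sub_mem h h')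
    have h2 : r • (x - x') - (z - z') = 0 := by
      rw [smul_sub, sub_sub_sub_comm, e, sub_self]
    rw [h2, norm_zero] at h1
    have h3 : ‖x - x'‖ ≤ 0 := nonpos_of_mul_nonpos_right h1 hr
    exact sub_eq_zero.1 (norm_le_zero_iff.1 h3)
  choose f g hfg hf using hs
  let L : E →ₗ[ℂ] E :=
    { toFun := f
      map_add' := fun x y => inj (hfg _) (A.graph.add_mem (hfg x) (hfg y)) (by
        rw [hf, smul_add, add_sub_add_comm, hf, hf])
      map_smul' := fun c x => inj (hfg _) (A.graph.smul_mem c (hfg x)) (by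
        rw [hf, RingHom.id_apply, smul_comm r c, ← smul_sub, hf]) }
  have hb : ∀ y, r * ‖f y‖ ≤ ‖y‖ := fun y => by
    simpa only [hf] using hA.mul_norm_le r (hfg y)
  refine ⟨L.mkContinuous r⁻¹ fun y => ?_, fun y => ?_, fun x z h => ?_, hb⟩
  · rw [inv_mul_eq_div, le_div_iff₀' hr]
    exact hb y
  · have e : r • f y - y = g y := by
      rw [sub_eq_iff_eq_add, ← sub_eq_iff_eq_add']
      exact hf y
    change (f y, r • f y - y) ∈ A.graph
    rw [e]
    exact hfg y
  · exact inj (hfg _) h (hf _)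

/-- The equation `C x - A x = y` reads `x = R (y - (C x - r x))` with `R = (r - A)⁻¹`. Since `‖R‖ ≤
1/r`, the right side is a contraction in `x` with ratio `q / r < 1`. -/
theorem exists_apply_sub_eq_of_close [CompleteSpace E] (hA : IsMDissipative A) {r : ℝ}
    (hr : 0 < r) (hs : ∀ y : E, ∃ x z : E, (x, z) ∈ A.graph ∧ r • x - z = y)
    (C : E →L[ℂ] E) {q : ℝ} (hq0 : 0 ≤ q) (hq : q < r) (hC : ∀ x, ‖C x - r • x‖ ≤ q * ‖x‖)
    (y : E) : ∃ x z : E, (x, z) ∈ A.graph ∧ C x - z = y := by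
  obtain ⟨R, hR⟩ := hA.exists_realResolvent hr hs
  let f : E → E := fun x => R (y - (C x - r • x))
  have hf : ContractingWith (Real.toNNReal (q / r)) f := by
    refine ⟨?_, LipschitzWith.of_dist_le_mul fun x x' => ?_⟩
    · rw [Real.toNNReal_lt_one, div_lt_one hr]
      exact hq
    · rw [Real.coe_toNNReal _ (by positivity), dist_eq_norm, dist_eq_norm, ← map_sub,
        div_mul_eq_mul_div, le_div_iff₀' hr]
      refine (hR.norm_apply_le _).trans ?_
      have e : y - (C x - r • x) - (y - (C x' - r • x')) = -(C (x - x') - r • (x - x')) := by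
        rw [map_sub, smul_sub]
        abel
      rw [e, norm_neg]
      exact hC _
  have hfix : f (hf.fixedPoint f) = hf.fixedPoint f := hf.fixedPoint_isFixedPt
  set x := hf.fixedPoint f
  have h := hR.mem_graph (y - (C x - r • x))
  have hfix' : R (y - (C x - r • x)) = x := hfix
  rw [hfix'] at h
  refine ⟨x, _, h, ?_⟩
  abel

theorem exists_smul_sub_eq [CompleteSpace E] (hA : IsMDissipative A) (k : ℕ) (y : E) :
    ∃ x z : E, (x, z) ∈ A.graph ∧ ((3 / 2 : ℝ) ^ k) • x - z = y := by
  induction k generalizing y with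
  | zero => simpa using hA.exists_sub_eq y
  | succ k ih =>
    have hk : (0 : ℝ) < (3 / 2) ^ k := by positivity
    -- Passing from `r` to `3r/2` is a perturbation of size `r/2 < r`. Any ratio strictly between 1
    -- and 2 would do, and its powers are unbounded.
    obtain ⟨x, z, h, e⟩ := hA.exists_apply_sub_eq_of_close hk ih
      (((3 / 2 : ℝ) ^ (k + 1)) • ContinuousLinearMap.id ℂ E) (q := (3 / 2) ^ k / 2)
      (by positivity) (by linarith) (fun x => by
        have e : ((3 / 2 : ℝ) ^ (k + 1)) • x - ((3 / 2 : ℝ) ^ k) • x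
            = ((3 / 2 : ℝ) ^ k / 2) • x := by
          rw [← sub_smul]
          congr 1
          ring
        change ‖((3 / 2 : ℝ) ^ (k + 1)) • x - ((3 / 2 : ℝ) ^ k) • x‖ ≤ _
        rw [e, norm_smul, Real.norm_of_nonneg (by positivity)]) y
    exact ⟨x, z, h, e⟩

/-- If `A` is m-dissipative and `C` is bounded and coercive, then `C - A` is surjective. -/
theorem exists_apply_sub_eq_of_coercive [CompleteSpace E] (hA : IsMDissipative A)
    (C : E →L[ℂ] E) {c : ℝ} (hc : 0 < c)
    (hC : ∀ x, c * ‖x‖ ^ 2 ≤ RCLike.re (inner ℂ x (C x))) (y : E) :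
    ∃ x z : E, (x, z) ∈ A.graph ∧ C x - z = y := by
  -- Expanding the square, `‖C x - r x‖² ≤ (‖C‖² + r² - 2rc) ‖x‖²`, and the factor is below `r²`
  -- exactly when `r > ‖C‖² / (2c)`.
  obtain ⟨k, hk⟩ := pow_unbounded_of_one_lt (‖C‖ ^ 2 / (2 * c))
    (by norm_num : (1 : ℝ) < 3 / 2)
  set r : ℝ := (3 / 2) ^ k
  have hr : 0 < r := by positivity
  have h1 : ‖C‖ ^ 2 < r * (2 * c) := (div_lt_iff₀ (by positivity)).1 hk
  refine hA.exists_apply_sub_eq_of_close hr (hA.exists_smul_sub_eq k) C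
    -- The maximum with 0 covers the trivial space, where `c` is arbitrary and the expression can be
    -- negative.
    (q := √(max (‖C‖ ^ 2 + r ^ 2 - 2 * r * c) 0)) (Real.sqrt_nonneg _) ?_ (fun x => ?_) y
  · rw [Real.sqrt_lt' hr, max_lt_iff]
    constructor
    · linarith
    · positivity
  · refine le_of_sq_le_sq ?_ (by positivity)
    rw [mul_pow, Real.sq_sqrt (le_max_right _ _), norm_sub_sq (𝕜 := ℂ), norm_smul,
      Real.norm_of_nonneg hr.le, inner_smul_right_eq_smul, RCLike.smul_re, ← inner_re_symm]
    have h4 : ‖C x‖ ^ 2 ≤ ‖C‖ ^ 2 * ‖x‖ ^ 2 := by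
      rw [← mul_pow]
      exact pow_le_pow_left₀ (norm_nonneg _) (C.le_opNorm x) 2
    have h5 := mul_le_mul_of_nonneg_left (hC x) hr.le
    refine le_trans ?_ (mul_le_mul_of_nonneg_right (le_max_left _ _) (sq_nonneg _))
    linarith

theorem exists_realResolvent_of_pos [CompleteSpace E] (hA : IsMDissipative A) {r : ℝ}
    (hr : 0 < r) : ∃ R : E →L[ℂ] E, IsRealResolvent A r R := by
  refine hA.exists_realResolvent hr fun y => ?_
  refine hA.exists_apply_sub_eq_of_coercive (r • ContinuousLinearMap.id ℂ E) hr (fun x => ?_) y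
  change _ ≤ RCLike.re (inner ℂ x (r • x))
  rw [inner_smul_right_eq_smul, RCLike.smul_re, inner_self_eq_norm_sq]

/-- A vector orthogonal to the domain can be written `w = x - A x`; pairing with `x` gives `‖x‖² =
⟨x, A x⟩`, whose real part is nonpositive, so `x = 0` and hence `w = 0`. -/
theorem dense_domain [CompleteSpace E] (hA : IsMDissipative A) : Dense (A.domain : Set E) := by
  rw [Submodule.dense_iff_topologicalClosure_eq_top,
    Submodule.topologicalClosure_eq_top_iff, Submodule.eq_bot_iff]
  intro w hw
  obtain ⟨x, z, h, rfl⟩ := hA.exists_sub_eq w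
  have h1 := (Submodule.mem_orthogonal _ _).1 hw x (LinearPMap.mem_domain_of_mem_graph h)
  have h2 := hA.re_inner_nonpos x z h
  rw [inner_sub_right, sub_eq_zero] at h1
  rw [← h1, inner_self_eq_norm_sq] at h2
  have h3 : x = 0 := norm_eq_zero.1 (pow_eq_zero_iff two_ne_zero |>.1 (le_antisymm h2 (sq_nonneg _)))
  rw [LinearPMap.graph_fst_eq_zero_snd A h h3, h3, sub_zero]

end IsMDissipative

/-! ### Resolvent identities. -/

namespace IsRealResolvent

variable {A : E →ₗ.[ℂ] E} {r s : ℝ} {R S : E →L[ℂ] E}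

theorem norm_le (hR : IsRealResolvent A r R) (hr : 0 < r) : ‖R‖ ≤ r⁻¹ :=
  R.opNorm_le_bound (by positivity) fun y => by
    rw [inv_mul_eq_div, le_div_iff₀' hr]
    exact hR.norm_apply_le y

/-- The resolvent identity: apply `R` to `(r - A) S y = (r - s) S y + y`. -/
theorem sub_eq (hR : IsRealResolvent A r R) (hS : IsRealResolvent A s S) :
    S - R = (r - s) • (R * S) := by
  ext y
  have h := hR.apply_sub _ _ (hS.mem_graph y)
  have e : r • S y - (s • S y - y) = (r - s) • S y + y := by
    rw [sub_smul]
    abel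
  rw [e, map_add, ContinuousLinearMap.map_smul_of_tower] at h
  change S y - R y = (r - s) • R (S y)
  rw [sub_eq_iff_eq_add]
  exact h.symm

theorem commute (hR : IsRealResolvent A r R) (hS : IsRealResolvent A s S) (hrs : r ≠ s) :
    Commute R S := by
  have h1 := hR.sub_eq hS
  have h2 := hS.sub_eq hR
  rw [← neg_sub S R, h1, ← neg_sub r s, neg_smul, neg_inj] at h2
  exact smul_right_injective _ (sub_ne_zero.2 hrs) h2

theorem smul_apply_sub (hR : IsRealResolvent A r R) {x z : E} (h : (x, z) ∈ A.graph) :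
    r • R x - x = R z := by
  have h1 := hR.apply_sub x z h
  rw [map_sub, ContinuousLinearMap.map_smul_of_tower] at h1
  rw [sub_eq_iff_eq_add', ← sub_eq_iff_eq_add]
  exact h1

end IsRealResolvent

end MDissipative

/-! ## The Lumer–Phillips theorem on Hilbert spaces -/

section LumerPhillips

/-- Compare power series termwise. The assumption is `‖1‖ ≤ 1` rather than equality so that
operators on the trivial space are included. -/
theorem NormedSpace.norm_exp_le_exp_norm {𝔸 : Type*} [NormedRing 𝔸] [NormedAlgebra ℝ 𝔸]
    [CompleteSpace 𝔸] (h1 : ‖(1 : 𝔸)‖ ≤ 1) (x : 𝔸) : ‖NormedSpace.exp x‖ ≤ Real.exp ‖x‖ := by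
  have hs := NormedSpace.expSeries_div_hasSum_exp (𝔸 := ℝ) ‖x‖
  rw [← Real.exp_eq_exp_ℝ] at hs
  rw [NormedSpace.exp_eq_tsum ℝ]
  refine tsum_of_norm_bounded hs fun k => ?_
  rw [norm_smul, div_eq_inv_mul, Real.norm_of_nonneg (by positivity)]
  refine mul_le_mul_of_nonneg_left ?_ (by positivity)
  rcases Nat.eq_zero_or_pos k with rfl | hk
  · simpa using h1
  · exact norm_pow_le' x hk

/-! ### Strong limits of contractions and exponentials of bounded operators. -/

section Normed

variable {E : Type*} [NormedAddCommGroup E] [NormedSpace ℂ E]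

theorem norm_apply_le_of_norm_le_one {T : E →L[ℂ] E} (hT : ‖T‖ ≤ 1) (x : E) : ‖T x‖ ≤ ‖x‖ := by
  simpa using T.le_of_opNorm_le hT x

/-- Contractions converging strongly to the identity on a dense set do so everywhere. -/
theorem tendsto_apply_of_dense {ι : Type*} {l : Filter ι} {F : ι → E →L[ℂ] E}
    (hF : ∀ i, ‖F i‖ ≤ 1) {D : Set E} (hD : Dense D)
    (h : ∀ x ∈ D, Tendsto (fun i => F i x) l (𝓝 x)) (x : E) :
    Tendsto (fun i => F i x) l (𝓝 x) := by
  rw [Metric.tendsto_nhds]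
  intro ε hε
  obtain ⟨d, hd, hxd⟩ := hD.exists_dist_lt x (by positivity : 0 < ε / 3)
  filter_upwards [Metric.tendsto_nhds.1 (h d hd) (ε / 3) (by positivity)] with i hi
  have h1 : dist (F i x) (F i d) ≤ dist x d := by
    rw [dist_eq_norm, dist_eq_norm, ← map_sub]
    exact norm_apply_le_of_norm_le_one (hF i) _
  have h3 := dist_triangle4 (F i x) (F i d) d x
  rw [dist_comm d x] at h3
  linarith

theorem cauchySeq_apply_of_dense {F : ℕ → E →L[ℂ] E}
    (hF : ∀ i, ‖F i‖ ≤ 1) {D : Set E} (hD : Dense D)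
    (h : ∀ x ∈ D, CauchySeq (fun i => F i x)) (x : E) : CauchySeq (fun i => F i x) := by
  rw [Metric.cauchySeq_iff]
  intro ε hε
  obtain ⟨d, hd, hxd⟩ := hD.exists_dist_lt x (by positivity : 0 < ε / 3)
  obtain ⟨N, hN⟩ := Metric.cauchySeq_iff.1 (h d hd) (ε / 3) (by positivity)
  refine ⟨N, fun m hm k hk => ?_⟩
  have h1 : ∀ i, dist (F i x) (F i d) ≤ dist x d := fun i => by
    rw [dist_eq_norm, dist_eq_norm, ← map_sub]
    exact norm_apply_le_of_norm_le_one (hF i) _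
  have h3 := dist_triangle4 (F m x) (F m d) (F k d) (F k x)
  have h4 := h1 m
  have h5 := h1 k
  have h6 := hN m hm k hk
  rw [dist_comm] at h5
  linarith

/-- Interpolate by `F s = e^{sP} e^{(t-s)Q}`. As `P` and `Q` commute, `F' = F (P - Q)`, and `F` is
contractive on `[0, t]`, so the mean value inequality applies. -/
theorem norm_exp_smul_apply_sub_le [CompleteSpace E] {P Q : E →L[ℂ] E} (hPQ : Commute P Q)
    (hP : ∀ t : ℝ, 0 ≤ t → ‖NormedSpace.exp (t • P)‖ ≤ 1)
    (hQ : ∀ t : ℝ, 0 ≤ t → ‖NormedSpace.exp (t • Q)‖ ≤ 1) {t : ℝ} (ht : 0 ≤ t) (x : E) :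
    ‖NormedSpace.exp (t • P) x - NormedSpace.exp (t • Q) x‖ ≤ t * ‖P x - Q x‖ := by
  let F : ℝ → E →L[ℂ] E := fun s => NormedSpace.exp (s • P) * NormedSpace.exp ((t - s) • Q)
  have hd : ∀ s : ℝ, HasDerivAt F (F s * (P - Q)) s := fun s => by
    have h1 := hasDerivAt_exp_smul_const P s
    have h2 := (hasDerivAt_exp_smul_const Q (t - s)).scomp s ((hasDerivAt_id s).const_sub t)
    refine (show HasDerivAt F _ s from h1.mul h2).congr_deriv ?_
    have h3 : Commute P (NormedSpace.exp ((t - s) • Q)) := (hPQ.smul_right _).exp_right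
    simp only [F, neg_smul, one_smul, mul_neg, ← sub_eq_add_neg, mul_sub,
      mul_assoc]
    rw [h3.eq]
  let ev : (E →L[ℂ] E) →L[ℝ] E := (ContinuousLinearMap.apply ℂ E x).restrictScalars ℝ
  have hd' : ∀ s : ℝ, HasDerivAt (fun s => F s x) (F s ((P - Q) x)) s := fun s =>
    ev.hasFDerivAt.comp_hasDerivAt s (hd s)
  have h := norm_image_sub_le_of_norm_deriv_le_segment' (a := 0) (b := t) (C := ‖P x - Q x‖)
    (fun s _ => (hd' s).hasDerivWithinAt) (fun s hs => by
      refine (norm_apply_le_of_norm_le_one (hP s hs.1) _).trans ?_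
      exact norm_apply_le_of_norm_le_one (hQ (t - s) (sub_nonneg.2 hs.2.le)) _)
      t (right_mem_Icc.2 ht)
  simpa [F, mul_comm] using h

theorem inv_coe_smul (t : ℝ) (x : E) : ((t : ℂ))⁻¹ • x = t⁻¹ • x := by
  rw [← Complex.ofReal_inv, Complex.coe_smul]

theorem tendsto_nnreal_coe_nhdsGT_zero :
    Tendsto (fun t : ℝ≥0 => (t : ℝ)) (𝓝[>] 0) (𝓝[>] 0) :=
  tendsto_nhdsWithin_iff.2 ⟨(NNReal.continuous_coe.tendsto' 0 0 rfl).mono_left nhdsWithin_le_nhds,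
    by filter_upwards [self_mem_nhdsWithin] with t ht using NNReal.coe_pos.2 ht⟩

end Normed

/-! ### Yosida approximation and generation. -/

variable {E : Type*} [NormedAddCommGroup E] [InnerProductSpace ℂ E] {A : E →ₗ.[ℂ] E}

/-- The Yosida approximation `r A (r - A)⁻¹` of `A`, where `R = (r - A)⁻¹`. -/
def yosida (r : ℝ) (R : E →L[ℂ] E) : E →L[ℂ] E := r • (r • R - 1)

namespace IsRealResolvent

variable {r s : ℝ} {R S : E →L[ℂ] E}

theorem yosida_apply (hR : IsRealResolvent A r R) {x z : E} (h : (x, z) ∈ A.graph) :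
    yosida r R x = r • R z := by
  rw [← hR.smul_apply_sub h]
  rfl

/-- Split off the scalar part: `t Y = -tr + t r² R`. The factor `e^{-tr}` cancels the bound `e^{t r²
‖R‖} ≤ e^{tr}`. -/
theorem norm_exp_yosida_le [CompleteSpace E] (hR : IsRealResolvent A r R) (hr : 0 < r) {t : ℝ}
    (ht : 0 ≤ t) : ‖NormedSpace.exp (t • yosida r R)‖ ≤ 1 := by
  let _ : NormedAlgebra ℚ (E →L[ℂ] E) := .restrictScalars ℚ ℝ _
  have h1 : ‖(1 : E →L[ℂ] E)‖ ≤ 1 := ContinuousLinearMap.norm_id_le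
  have e : t • yosida r R = algebraMap ℝ (E →L[ℂ] E) (-(t * r)) + (t * r ^ 2) • R := by
    rw [yosida, Algebra.algebraMap_eq_smul_one, smul_sub, smul_sub, neg_smul, smul_smul, smul_smul,
      smul_smul, sub_eq_neg_add]
    ring_nf
  rw [e, NormedSpace.exp_add_of_commute (Algebra.commute_algebraMap_left _ _),
    ← NormedSpace.algebraMap_exp_comm, Algebra.algebraMap_eq_smul_one, smul_mul_assoc, one_mul,
    norm_smul, ← Real.exp_eq_exp_ℝ, Real.norm_of_nonneg (Real.exp_pos _).le]
  have h2 : ‖(t * r ^ 2) • R‖ ≤ t * r := by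
    rw [norm_smul, Real.norm_of_nonneg (by positivity)]
    refine (mul_le_mul_of_nonneg_left (hR.norm_le hr) (by positivity)).trans_eq ?_
    field_simp
  calc Real.exp (-(t * r)) * ‖NormedSpace.exp ((t * r ^ 2) • R)‖
      ≤ Real.exp (-(t * r)) * Real.exp (t * r) := by
        gcongr
        exact (NormedSpace.norm_exp_le_exp_norm h1 _).trans (Real.exp_le_exp.2 h2)
    _ = 1 := by rw [← Real.exp_add, neg_add_cancel, Real.exp_zero]

theorem commute_yosida (hR : IsRealResolvent A r R) (hS : IsRealResolvent A s S) (hrs : r ≠ s) :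
    Commute (yosida r R) (yosida s S) := by
  have h : Commute (r • R - 1) (s • S - 1) :=
    ((((hR.commute hS hrs).smul_left r).smul_right s).sub_left (Commute.one_left _)).sub_right
      (Commute.one_right _)
  exact (h.smul_left r).smul_right s

end IsRealResolvent

namespace IsMDissipative

/-- On the domain, `r R x - x = R A x` has norm at most `‖A x‖ / r`; density and `‖r R‖ ≤ 1` give
the rest. -/
theorem tendsto_smul_resolvent [CompleteSpace E] (hA : IsMDissipative A) {r : ℕ → ℝ}
    (hr : Tendsto r atTop atTop) (hr0 : ∀ k, 0 < r k) {R : ℕ → E →L[ℂ] E}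
    (hR : ∀ k, IsRealResolvent A (r k) (R k)) (x : E) :
    Tendsto (fun k => r k • R k x) atTop (𝓝 x) := by
  refine tendsto_apply_of_dense (F := fun k => r k • R k) (fun k => ?_) hA.dense_domain
    (fun x hx => ?_) x
  · rw [norm_smul, Real.norm_of_nonneg (hr0 k).le]
    exact (mul_le_mul_of_nonneg_left ((hR k).norm_le (hr0 k)) (hr0 k).le).trans_eq
      (mul_inv_cancel₀ (hr0 k).ne')
  · obtain ⟨z, hz⟩ := LinearPMap.mem_domain_iff.1 hx
    rw [tendsto_iff_norm_sub_tendsto_zero]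
    refine squeeze_zero (fun _ => norm_nonneg _) (fun k => ?_)
      (by simpa using hr.inv_tendsto_atTop.mul_const ‖z‖)
    change ‖r k • R k x - x‖ ≤ (r k)⁻¹ * ‖z‖
    rw [(hR k).smul_apply_sub hz]
    exact (R k).le_of_opNorm_le ((hR k).norm_le (hr0 k)) z

end IsMDissipative

/-- The difference quotients of `T` and of `e^{tY_k}` at `x` differ by at most `‖Y_k x - z‖`,
uniformly in `t`. Fix `k` making this small, then let `t` tend to 0. -/
theorem tendsto_sub_div_of_norm_exp_sub_le {Y : ℕ → E →L[ℂ] E} {T : ℝ≥0 → E →L[ℂ] E} [CompleteSpace E]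
    {x z : E} (hY : Tendsto (fun k => Y k x) atTop (𝓝 z))
    (hT : ∀ k (t : ℝ≥0), ‖NormedSpace.exp ((t : ℝ) • Y k) x - T t x‖ ≤ t * ‖Y k x - z‖) :
    Tendsto (fun t : ℝ≥0 => (((t : ℝ) : ℂ))⁻¹ • (T t x - x)) (𝓝[>] 0) (𝓝 z) := by
  simp_rw [inv_coe_smul]
  rw [Metric.tendsto_nhds]
  intro ε hε
  obtain ⟨k, hk⟩ := (Metric.tendsto_nhds.1 hY (ε / 3) (by positivity)).exists
  have hd : HasDerivAt (fun t : ℝ => NormedSpace.exp (t • Y k) x) (Y k x) 0 := by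
    let ev : (E →L[ℂ] E) →L[ℝ] E := (ContinuousLinearMap.apply ℂ E x).restrictScalars ℝ
    have h : HasDerivAt (fun t : ℝ => NormedSpace.exp (t • Y k) x)
        ((NormedSpace.exp ((0 : ℝ) • Y k) * Y k) x) 0 :=
      ev.hasFDerivAt.comp_hasDerivAt (0 : ℝ) (hasDerivAt_exp_smul_const (Y k) (0 : ℝ))
    simpa using h
  have hs := ((hasDerivAt_iff_tendsto_slope_zero.1 hd).mono_left
    (nhdsWithin_mono _ fun t ht => ne_of_gt ht)).comp tendsto_nnreal_coe_nhdsGT_zero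
  filter_upwards [Metric.tendsto_nhds.1 hs (ε / 3) (by positivity), self_mem_nhdsWithin]
    with t ht ht0
  have ht0' : (0 : ℝ) < t := NNReal.coe_pos.2 ht0
  have h1 : dist ((t : ℝ)⁻¹ • (T t x - x)) ((t : ℝ)⁻¹ • (NormedSpace.exp ((t : ℝ) • Y k) x - x))
      ≤ dist (Y k x) z := by
    rw [dist_comm, dist_eq_norm, dist_eq_norm, ← smul_sub, sub_sub_sub_cancel_right, norm_smul,
      Real.norm_of_nonneg (by positivity), inv_mul_le_iff₀ ht0']
    exact hT k t
  simp only [Function.comp_apply, zero_add, zero_smul, NormedSpace.exp_zero,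
    one_apply_eq_self] at ht
  have h2 := dist_triangle4 ((t : ℝ)⁻¹ • (T t x - x))
    ((t : ℝ)⁻¹ • (NormedSpace.exp ((t : ℝ) • Y k) x - x)) (Y k x) z
  linarith

/-- Contractivity gives `Re ⟨x, T t x - x⟩ ≤ ‖x‖ ‖T t x‖ - ‖x‖² ≤ 0`; divide by `t` and pass to the
limit. -/
theorem re_inner_nonpos_of_tendsto_sub_div {T : ℝ≥0 → E →L[ℂ] E}
    (hT : ∀ t, ‖T t‖ ≤ 1) {x z : E}
    (h : Tendsto (fun t : ℝ≥0 => (((t : ℝ) : ℂ))⁻¹ • (T t x - x)) (𝓝[>] 0) (𝓝 z)) :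
    RCLike.re (inner ℂ x z) ≤ 0 := by
  have h1 : Tendsto (fun t : ℝ≥0 => RCLike.re (inner ℂ x ((((t : ℝ) : ℂ))⁻¹ • (T t x - x))))
      (𝓝[>] 0) (𝓝 (RCLike.re (inner ℂ x z))) :=
    (RCLike.continuous_re.tendsto _).comp (tendsto_const_nhds.inner h)
  refine le_of_tendsto h1 (Eventually.of_forall fun t => ?_)
  rw [inv_coe_smul, inner_smul_right_eq_smul, RCLike.smul_re, inner_sub_right, map_sub,
    inner_self_eq_norm_sq]
  refine mul_nonpos_of_nonneg_of_nonpos (by positivity) ?_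
  have h2 := re_inner_le_norm (𝕜 := ℂ) x (T t x)
  have h3 := norm_apply_le_of_norm_le_one (hT t) x
  nlinarith [norm_nonneg x]

/-- An m-dissipative operator on a Hilbert space generates a contraction semigroup. -/
theorem IsMDissipative.generatesContractionSemigroup [CompleteSpace E] (hA : IsMDissipative A) :
    GeneratesContractionSemigroup A := by
  let r : ℕ → ℝ := fun k => k + 1
  have hr0 : ∀ k, 0 < r k := fun k => by positivity
  have hr : Tendsto r atTop atTop := tendsto_atTop_add_const_right _ _ tendsto_natCast_atTop_atTop
  choose R hR using fun k => hA.exists_realResolvent_of_pos (hr0 k)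
  let Y : ℕ → E →L[ℂ] E := fun k => yosida (r k) (R k)
  have hYn : ∀ k (t : ℝ), 0 ≤ t → ‖NormedSpace.exp (t • Y k)‖ ≤ 1 :=
    fun k t ht => (hR k).norm_exp_yosida_le (hr0 k) ht
  have hYc : ∀ k m, Commute (Y k) (Y m) := fun k m => by
    rcases eq_or_ne k m with rfl | hkm
    · exact Commute.refl _
    · exact (hR k).commute_yosida (hR m) (by simpa [r] using hkm)
  have hYlim : ∀ x z, (x, z) ∈ A.graph → Tendsto (fun k => Y k x) atTop (𝓝 z) := fun x z h => by
    refine (hA.tendsto_smul_resolvent hr hr0 hR z).congr fun k => ?_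
    exact ((hR k).yosida_apply h).symm
  have hdiff : ∀ k m (t : ℝ≥0) x, ‖NormedSpace.exp ((t : ℝ) • Y k) x
      - NormedSpace.exp ((t : ℝ) • Y m) x‖ ≤ t * ‖Y k x - Y m x‖ := fun k m t x =>
    norm_exp_smul_apply_sub_le (hYc k m) (hYn k) (hYn m) t.2 x
  have hcauchy : ∀ (t : ℝ≥0) x, CauchySeq fun k => NormedSpace.exp ((t : ℝ) • Y k) x := by
    intro t
    refine cauchySeq_apply_of_dense (fun k => hYn k t t.2) hA.dense_domain fun x hx => ?_
    obtain ⟨z, hz⟩ := LinearPMap.mem_domain_iff.1 hx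
    rw [Metric.cauchySeq_iff]
    intro ε hε
    obtain ⟨N, hN⟩ := Metric.cauchySeq_iff.1 (hYlim x z hz).cauchySeq (ε / (t + 1))
      (by positivity)
    refine ⟨N, fun k hk m hm => ?_⟩
    have h1 := hN k hk m hm
    rw [dist_eq_norm, lt_div_iff₀ (by positivity)] at h1
    rw [dist_eq_norm]
    refine (hdiff k m t x).trans_lt (lt_of_le_of_lt ?_ h1)
    nlinarith [norm_nonneg (Y k x - Y m x)]
  choose L hL using fun (t : ℝ≥0) x => cauchySeq_tendsto_of_complete (hcauchy t x)
  let T : ℝ≥0 → E →L[ℂ] E := fun t =>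
    -- Banach–Steinhaus makes the pointwise limit a bounded operator.
    continuousLinearMapOfTendsto (fun k => NormedSpace.exp ((t : ℝ) • Y k))
      (tendsto_pi_nhds.2 (hL t))
  have hT : ∀ (t : ℝ≥0) x, Tendsto (fun k => NormedSpace.exp ((t : ℝ) • Y k) x) atTop
    (𝓝 (T t x)) := hL
  have hTn : ∀ t, ‖T t‖ ≤ 1 := fun t => (T t).opNorm_le_bound zero_le_one fun x =>
    le_of_tendsto (hT t x).norm (Eventually.of_forall fun k =>
      (NormedSpace.exp ((t : ℝ) • Y k)).le_of_opNorm_le (hYn k t t.2) x)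
  have hder : ∀ x z, (x, z) ∈ A.graph →
      Tendsto (fun t : ℝ≥0 => (((t : ℝ) : ℂ))⁻¹ • (T t x - x)) (𝓝[>] 0) (𝓝 z) := by
    intro x z h
    refine tendsto_sub_div_of_norm_exp_sub_le (hYlim x z h) fun k t => ?_
    exact le_of_tendsto_of_tendsto (tendsto_const_nhds.sub (hT t x)).norm
      ((tendsto_const_nhds.sub (hYlim x z h)).norm.const_mul _)
      (Eventually.of_forall fun m => hdiff k m t x)
  refine ⟨T, ⟨?_, fun s t => ?_, ?_, hTn⟩, fun x y => ⟨hder x y, fun h => ?_⟩⟩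
  · ext x
    refine tendsto_nhds_unique (hT 0 x) ?_
    simp [NormedSpace.exp_zero]
  · ext x
    refine tendsto_nhds_unique (hT (s + t) x) ?_
    -- Replacing the inner exponential by its limit costs only a term that the contraction
    -- `e^{sY_k}` does not enlarge.
    have e : ∀ k, NormedSpace.exp (((s + t : ℝ≥0) : ℝ) • Y k) x
        = NormedSpace.exp ((s : ℝ) • Y k) (T t x)
          + NormedSpace.exp ((s : ℝ) • Y k) (NormedSpace.exp ((t : ℝ) • Y k) x - T t x) := by
      intro k
      let _ : NormedAlgebra ℚ (E →L[ℂ] E) := .restrictScalars ℚ ℝ _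
      rw [← map_add, add_sub_cancel, NNReal.coe_add, add_smul, NormedSpace.exp_add_of_commute
        (((Commute.refl (Y k)).smul_left _).smul_right _)]
      rfl
    simp_rw [e]
    rw [ContinuousLinearMap.comp_apply, ← add_zero (T s (T t x))]
    refine (hT s _).add (squeeze_zero_norm (fun k => ?_)
      (tendsto_iff_norm_sub_tendsto_zero.1 (hT t x)))
    exact norm_apply_le_of_norm_le_one (hYn k s s.2) _
  · refine tendsto_apply_of_dense hTn hA.dense_domain fun x hx => ?_
    obtain ⟨z, hz⟩ := LinearPMap.mem_domain_iff.1 hx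
    have h1 : Tendsto (fun t : ℝ≥0 => ((t : ℝ) : ℂ)) (𝓝[>] 0) (𝓝 0) :=
      ((Complex.continuous_ofReal.comp NNReal.continuous_coe).tendsto' 0 0 (by simp)).mono_left
        nhdsWithin_le_nhds
    have h2 := (h1.smul (hder x z hz)).add_const x
    rw [zero_smul, zero_add] at h2
    refine h2.congr' ?_
    filter_upwards [self_mem_nhdsWithin] with t ht
    have ht' : ((t : ℝ) : ℂ) ≠ 0 := by
      simpa using (ne_of_gt ht : t ≠ 0)
    rw [smul_inv_smul₀ ht', sub_add_cancel]
  -- The generator of `T` extends `A`; it is no larger. Solving `x' - A x' = x - y`, the vector `x -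
  -- x'` has right derivative equal to itself, so dissipativity forces it to vanish.
  · obtain ⟨x', z', h', e⟩ := hA.exists_sub_eq (x - y)
    have h1 := h.sub (hder x' z' h')
    simp_rw [← smul_sub, sub_sub_sub_comm _ x, ← map_sub] at h1
    have e' : y - z' = x - x' := by
      have : y - z' - (x - x') = x' - z' - (x - y) := by abel
      rw [← sub_eq_zero, this, e, sub_self]
    have h2 := re_inner_nonpos_of_tendsto_sub_div hTn h1
    rw [e', inner_self_eq_norm_sq] at h2
    have h3 : x - x' = 0 :=
      norm_eq_zero.1 (pow_eq_zero_iff two_ne_zero |>.1 (le_antisymm h2 (sq_nonneg _)))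
    rw [h3, sub_eq_zero] at e'
    rw [sub_eq_zero.1 h3, e']
    exact h'

/-! ### From a contraction semigroup to m-dissipativity. -/

namespace IsContractionSemigroup

variable {T : ℝ≥0 → E →L[ℂ] E}

/-- The semigroup law and contractivity give `‖T s y - T t y‖ ≤ ‖T |s - t| y - y‖`, reducing to
continuity at 0. It makes the Laplace integrand continuous. -/
theorem continuous_apply (hT : IsContractionSemigroup T) (y : E) :
    Continuous fun t => T t y := by
  have h0 : Tendsto (fun t : ℝ≥0 => ‖T t y - y‖) (𝓝 0) (𝓝 0) := by
    have h1 : ContinuousWithinAt (fun t : ℝ≥0 => T t y) (Ioi 0) 0 := by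
      simpa [ContinuousWithinAt, hT.map_zero] using hT.strongly_continuous y
    have h2 : ContinuousAt (fun t : ℝ≥0 => T t y) 0 := by
      have h3 := continuousWithinAt_Ioi_iff_Ici.1 h1
      have e : Ici (0 : ℝ≥0) = univ := by ext; simp
      rwa [e, continuousWithinAt_univ] at h3
    have h4 : Tendsto (fun t : ℝ≥0 => T t y) (𝓝 0) (𝓝 y) := by
      simpa [ContinuousAt, hT.map_zero] using h2
    exact tendsto_iff_norm_sub_tendsto_zero.1 h4
  have key : ∀ s h : ℝ≥0, ‖T (s + h) y - T s y‖ ≤ ‖T h y - y‖ := fun s h => by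
    rw [hT.map_add, ContinuousLinearMap.comp_apply, ← map_sub]
    exact norm_apply_le_of_norm_le_one (hT.norm_le_one s) _
  have key' : ∀ s t : ℝ≥0, ‖T s y - T t y‖ ≤ ‖T (nndist s t) y - y‖ := by
    have hle : ∀ s t : ℝ≥0, s ≤ t → ‖T t y - T s y‖ ≤ ‖T (nndist t s) y - y‖ := fun s t hst => by
      obtain ⟨h, rfl⟩ := exists_add_of_le hst
      have e : nndist (s + h) s = h := by
        ext
        simp [NNReal.dist_eq]
      rw [e]
      exact key s h
    intro s t
    rcases le_total s t with hst | hst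
    · rw [norm_sub_rev, nndist_comm]
      exact hle s t hst
    · exact hle t s hst
  refine continuous_iff_continuousAt.2 fun t => ?_
  rw [ContinuousAt, tendsto_iff_norm_sub_tendsto_zero]
  refine squeeze_zero (fun _ => norm_nonneg _) (fun s => key' s t) (h0.comp ?_)
  exact (continuous_id.nndist continuous_const).tendsto' t 0 (nndist_self t)

/-- The range of `1 - A` is the whole space: the Laplace transform of the semigroup at `1`. -/
theorem exists_tendsto_sub_div [CompleteSpace E] (hT : IsContractionSemigroup T) (y : E) :
    ∃ x : E, Tendsto (fun t : ℝ≥0 => (((t : ℝ) : ℂ))⁻¹ • (T t x - x)) (𝓝[>] 0) (𝓝 (x - y)) := by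
  let f : ℝ → E := fun s => Real.exp (-s) • T s.toNNReal y
  have hf : Continuous f := (Real.continuous_exp.comp continuous_neg).smul
    ((hT.continuous_apply y).comp continuous_real_toNNReal)
  have hint : IntegrableOn f (Ioi 0) := by
    have h1 : IntegrableOn (fun s : ℝ => Real.exp (-1 * s) * ‖y‖) (Ioi 0) :=
      (exp_neg_integrableOn_Ioi 0 one_pos).mul_const _
    refine Integrable.mono' h1 hf.aestronglyMeasurable (Eventually.of_forall fun s => ?_)
    rw [norm_smul, Real.norm_of_nonneg (Real.exp_pos _).le, neg_one_mul]
    exact mul_le_mul_of_nonneg_left (norm_apply_le_of_norm_le_one (hT.norm_le_one _) _)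
      (Real.exp_pos _).le
  -- With `x = ∫₀^∞ e^{-s} T(s) y ds`, the orbit is `T(h) x = e^h ∫_h^∞ f` for `h ≥ 0`. Writing the
  -- tail as a difference defines it for all real `h`, with derivative `x - y` at 0.
  let φ : ℝ → E := fun h => Real.exp h • ((∫ s in Ioi (0 : ℝ), f s) - ∫ s in (0 : ℝ)..h, f s)
  have hφ0 : φ 0 = ∫ s in Ioi (0 : ℝ), f s := by simp [φ]
  have hφ : HasDerivAt φ ((∫ s in Ioi (0 : ℝ), f s) - y) 0 := by
    have h1 := (Real.hasDerivAt_exp 0).smul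
      (((hf.integral_hasStrictDerivAt 0 0).hasDerivAt).const_sub (∫ s in Ioi (0 : ℝ), f s))
    refine (show HasDerivAt φ _ 0 from h1).congr_deriv ?_
    simp [f, hT.map_zero, sub_eq_neg_add]
  have hTφ : ∀ t : ℝ≥0, T t (∫ s in Ioi (0 : ℝ), f s) = φ t := by
    intro t
    have e : ∀ s ∈ Ioi (0 : ℝ), T t (f s) = Real.exp t • f (s + t) := by
      intro s hs
      have hs' : (0 : ℝ) ≤ s := le_of_lt hs
      have e1 : (s + t).toNNReal = t + s.toNNReal := by
        rw [Real.toNNReal_add hs' t.coe_nonneg, Real.toNNReal_coe, add_comm]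
      have e2 : (t : ℝ) + -(s + t) = -s := by ring
      simp only [f]
      rw [ContinuousLinearMap.map_smul_of_tower, smul_smul, ← Real.exp_add,
        ← ContinuousLinearMap.comp_apply, ← hT.map_add, e1, e2]
    rw [← ContinuousLinearMap.integral_comp_comm _ hint, setIntegral_congr_fun measurableSet_Ioi e,
      integral_smul]
    have hpre : (fun s : ℝ => s + t) ⁻¹' Ioi (t : ℝ) = Ioi 0 := by
      ext s
      simp
    rw [← hpre, (measurePreserving_add_right volume (t : ℝ)).setIntegral_preimage_emb
      (measurableEmbedding_addRight (t : ℝ)) f]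
    simp only [φ]
    rw [← intervalIntegral.integral_Ioi_sub_Ioi hint t.coe_nonneg, sub_sub_cancel]
  refine ⟨∫ s in Ioi (0 : ℝ), f s, ?_⟩
  simp_rw [inv_coe_smul]
  have hs := ((hasDerivAt_iff_tendsto_slope_zero.1 hφ).mono_left
    (nhdsWithin_mono _ fun t ht => ne_of_gt ht)).comp tendsto_nnreal_coe_nhdsGT_zero
  refine hs.congr fun t => ?_
  rw [Function.comp_apply, zero_add, hφ0, hTφ]

end IsContractionSemigroup

/-- The Lumer–Phillips theorem on Hilbert spaces. -/
theorem generatesContractionSemigroup_iff_isMDissipative [CompleteSpace E] :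
    GeneratesContractionSemigroup A ↔ IsMDissipative A := by
  refine ⟨fun ⟨T, hT, hA⟩ => ⟨fun x z h => ?_, fun y => ?_⟩,
    fun h => h.generatesContractionSemigroup⟩
  · exact re_inner_nonpos_of_tendsto_sub_div hT.norm_le_one ((hA x z).1 h)
  · obtain ⟨x, hx⟩ := hT.exists_tendsto_sub_div y
    exact ⟨x, x - y, (hA _ _).2 hx, sub_sub_cancel x y⟩

end LumerPhillips

/-! ## Bounded multiplication operators and the energy norm -/

namespace PortHamiltonian

variable {n : ℕ}

theorem norm_toLp_mulVec_le (M : Matrix (Fin n) (Fin n) ℂ) (v : EuclideanSpace ℂ (Fin n)) :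
    ‖(WithLp.toLp 2 (M.mulVec v.ofLp) : EuclideanSpace ℂ (Fin n))‖
      ≤ (∑ i, ∑ j, ‖M i j‖) * ‖v‖ := by
  have h1 : ‖(WithLp.toLp 2 (M.mulVec v.ofLp) : EuclideanSpace ℂ (Fin n))‖
      ≤ ∑ i, ‖M.mulVec v.ofLp i‖ := by
    rw [EuclideanSpace.norm_eq]
    exact Real.sqrt_le_iff.2 ⟨Finset.sum_nonneg fun i _ => norm_nonneg _,
      Finset.sum_sq_le_sq_sum_of_nonneg fun i _ => norm_nonneg _⟩
  refine h1.trans ?_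
  rw [Finset.sum_mul]
  refine Finset.sum_le_sum fun i _ => ?_
  rw [Finset.sum_mul]
  rw [Matrix.mulVec, dotProduct]
  refine (norm_sum_le _ _).trans (Finset.sum_le_sum fun j _ => ?_)
  rw [norm_mul]
  exact mul_le_mul_of_nonneg_left (PiLp.norm_apply_le v j) (norm_nonneg _)

theorem exists_norm_matMul_le (M : ℝ → Matrix (Fin n) (Fin n) ℂ) (hM : EssBounded M) :
    ∃ C : ℝ, 0 < C ∧ ∀ x, ‖matMul M hM x‖ ≤ C * ‖x‖ := by
  have hb : ∀ i j, ∀ᵐ ζ ∂μ₀₁, ‖M ζ i j‖ ≤ (eLpNormEssSup (fun ζ => M ζ i j) μ₀₁).toReal := by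
    intro i j
    filter_upwards [ae_le_eLpNormEssSup (f := fun ζ => M ζ i j) (μ := μ₀₁)] with ζ hζ
    rw [← toReal_enorm]
    refine ENNReal.toReal_mono ?_ hζ
    have h := (hM i j).2
    rw [eLpNorm_exponent_top] at h
    exact h.ne
  -- The added 1 keeps the constant positive even when the sum vanishes.
  refine ⟨(∑ i, ∑ j, (eLpNormEssSup (fun ζ => M ζ i j) μ₀₁).toReal) + 1, ?_, fun x => ?_⟩
  · have : 0 ≤ ∑ i, ∑ j, (eLpNormEssSup (fun ζ => M ζ i j) μ₀₁).toReal :=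
      Finset.sum_nonneg fun i _ => Finset.sum_nonneg fun j _ => ENNReal.toReal_nonneg
    linarith
  · refine Lp.norm_le_mul_norm_of_ae_le_mul ?_
    filter_upwards [matMul_coeFn M hM x, ae_all_iff.2 fun i => ae_all_iff.2 (hb i)] with ζ h1 h2
    rw [h1]
    refine (norm_toLp_mulVec_le _ _).trans (mul_le_mul_of_nonneg_right ?_ (norm_nonneg _))
    exact (Finset.sum_le_sum fun i _ => Finset.sum_le_sum fun j _ => h2 i j).trans
      (le_add_of_nonneg_right zero_le_one)

theorem matMul_matMul_of_mul_eq_one {M N : ℝ → Matrix (Fin n) (Fin n) ℂ} (hM : EssBounded M)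
    (hN : EssBounded N) (h : ∀ᵐ ζ ∂μ₀₁, M ζ * N ζ = 1) (x : X₂ n) :
    matMul M hM (matMul N hN x) = x := by
  refine Lp.ext ?_
  filter_upwards [matMul_coeFn M hM (matMul N hN x), matMul_coeFn N hN x, h] with ζ h1 h2 h3
  rw [h1, h2, Matrix.mulVec_mulVec, h3, Matrix.one_mulVec]

namespace HamiltonianDensity

variable (H : HamiltonianDensity n)

/-- Multiplication by `ℋ⁻¹` on `L²(0,1; ℂⁿ)`. -/
def mulInv : X₂ n →ₗ[ℂ] X₂ n := matMul (fun ζ => (H.toFun ζ)⁻¹) H.essBounded_inv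

theorem mul_mulInv (x : X₂ n) : H.mul (H.mulInv x) = x :=
  matMul_matMul_of_mul_eq_one _ _ (H.posDef.mono fun _ h =>
    Matrix.mul_nonsing_inv _ ((Matrix.isUnit_iff_isUnit_det _).1 h.isUnit)) x

theorem mulInv_mul (x : X₂ n) : H.mulInv (H.mul x) = x :=
  matMul_matMul_of_mul_eq_one _ _ (H.posDef.mono fun _ h =>
    Matrix.nonsing_inv_mul _ ((Matrix.isUnit_iff_isUnit_det _).1 h.isUnit)) x

theorem exists_norm_mulInv_le : ∃ C : ℝ, 0 < C ∧ ∀ x, ‖H.mulInv x‖ ≤ C * ‖x‖ :=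
  exists_norm_matMul_le _ H.essBounded_inv

theorem inner_mul_left (x y : X₂ n) : inner ℂ (H.mul x) y = inner ℂ x (H.mul y) := by
  rw [← H.conj_inner, inner_conj_symm]

end HamiltonianDensity

/-! ### Comparison of the energy norm with the standard norm. -/

namespace EnergySpace

variable (H : HamiltonianDensity n)

theorem norm_sq_eq (x : EnergySpace H) :
    ‖x‖ ^ 2 = RCLike.re (inner ℂ (toL2 H x) (H.mul (toL2 H x))) := by
  rw [← inner_def, inner_self_eq_norm_sq]

theorem exists_norm_le : ∃ a : ℝ, 0 < a ∧ ∀ x : EnergySpace H,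
    ‖x‖ ≤ a * ‖toL2 H x‖ ∧ ‖H.mul (toL2 H x)‖ ≤ a * ‖x‖ := by
  obtain ⟨C, hC, hb⟩ := exists_norm_matMul_le H.toFun H.essBounded
  have h1 : ∀ x : EnergySpace H, ‖x‖ ≤ √C * ‖toL2 H x‖ := fun x => by
    refine le_of_sq_le_sq ?_ (by positivity)
    rw [norm_sq_eq, mul_pow, Real.sq_sqrt hC.le]
    refine (re_inner_le_norm _ _).trans ?_
    have := mul_le_mul_of_nonneg_left (hb (toL2 H x)) (norm_nonneg (toL2 H x))
    calc _ ≤ ‖toL2 H x‖ * (C * ‖toL2 H x‖) := this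
      _ = _ := by ring
  refine ⟨√C, Real.sqrt_pos.2 hC, fun x => ⟨h1 x, ?_⟩⟩
  set y := H.mul (toL2 H x) with hy
  -- For `y = ℋ x` one has `‖y‖² = ⟨y, x⟩_ℋ`. Cauchy–Schwarz in the energy inner product then gives
  -- the second bound without a square root of `ℋ`.
  have h2 : ‖y‖ ^ 2 ≤ √C * ‖y‖ * ‖x‖ := by
    have e : RCLike.re (inner ℂ ((toL2 H).symm y) x) = ‖y‖ ^ 2 := by
      rw [inner_def, LinearEquiv.apply_symm_apply, ← hy, inner_self_eq_norm_sq]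
    rw [← e]
    refine (re_inner_le_norm _ _).trans (mul_le_mul_of_nonneg_right ?_ (norm_nonneg _))
    simpa using h1 ((toL2 H).symm y)
  rcases (norm_nonneg y).eq_or_lt with h0 | h0
  · rw [← h0]
    positivity
  · refine le_of_mul_le_mul_left ?_ h0
    linarith

theorem exists_norm_toL2_le : ∃ b : ℝ, 0 < b ∧ ∀ x : EnergySpace H, ‖toL2 H x‖ ≤ b * ‖x‖ := by
  obtain ⟨a, ha, h⟩ := exists_norm_le H
  obtain ⟨C, hC, hb⟩ := H.exists_norm_mulInv_le
  refine ⟨C * a, by positivity, fun x => ?_⟩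
  have h1 : ‖toL2 H x‖ ≤ C * ‖H.mul (toL2 H x)‖ := by
    have h2 : ‖H.mulInv (H.mul (toL2 H x))‖ ≤ C * ‖H.mul (toL2 H x)‖ := hb _
    rwa [H.mulInv_mul] at h2
  rw [mul_assoc]
  exact h1.trans (mul_le_mul_of_nonneg_left (h x).2 hC.le)

/-- The two norms are equivalent, so completeness carries over; Lumer–Phillips can then be used on
the energy space. -/
instance : CompleteSpace (EnergySpace H) := by
  obtain ⟨a, -, ha⟩ := exists_norm_le H
  obtain ⟨b, -, hb⟩ := exists_norm_toL2_le H
  let e : EnergySpace H ≃L[ℂ] X₂ n := (toL2 H).toContinuousLinearEquivOfBounds b a hb fun x => by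
    simpa using (ha ((toL2 H).symm x)).1
  exact (completeSpace_congr (e := e.toEquiv) e.isUniformEmbedding).2 inferInstance

theorem inner_eq (x z : EnergySpace H) :
    inner ℂ x z = inner ℂ (H.mul (toL2 H x)) (toL2 H z) := by
  rw [inner_def, H.inner_mul_left]

end EnergySpace

open EnergySpace

/-! ## Transfer of m-dissipativity between `A` and `A ℋ` -/

variable {P₁ P₀ : Matrix (Fin n) (Fin n) ℂ} {WB : Matrix (Fin n) (Fin n ⊕ Fin n) ℂ}
  (H : HamiltonianDensity n)

theorem mem_graph_opAH_iff {x z : EnergySpace H} :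
    (x, z) ∈ (opAH P₁ P₀ WB H).graph ↔
      (H.mul (toL2 H x), toL2 H z) ∈ (opA P₁ P₀ WB).graph := by
  rw [LinearPMap.mem_graph_iff, LinearPMap.mem_graph_iff]
  constructor
  · rintro ⟨y, rfl, rfl⟩
    exact ⟨⟨H.mul (toL2 H y), y.2⟩, rfl, rfl⟩
  · rintro ⟨⟨w, hw⟩, hwx, hwz⟩
    obtain rfl : w = H.mul (toL2 H x) := hwx
    exact ⟨⟨x, hw⟩, rfl, hwz⟩

theorem isMDissipative_opAH (hA : IsMDissipative (opA P₁ P₀ WB)) :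
    IsMDissipative (opAH P₁ P₀ WB H) := by
  refine ⟨fun x z h => ?_, fun y => ?_⟩
  · rw [inner_eq]
    exact hA.re_inner_nonpos _ _ ((mem_graph_opAH_iff H).1 h)
  · obtain ⟨a, ha, hn⟩ := exists_norm_le H
    obtain ⟨C, -, hb⟩ := H.exists_norm_mulInv_le
    -- Take `C = ℋ⁻¹`. For `w = ℋ x`, `⟨w, ℋ⁻¹ w⟩` is `‖x‖²` in the energy norm, hence at least
    -- `‖w‖² / a²`.
    obtain ⟨w, v, h, e⟩ := hA.exists_apply_sub_eq_of_coercive (H.mulInv.mkContinuous C hb)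
      (c := (a ^ 2)⁻¹) (by positivity) (fun w => by
        obtain ⟨x, rfl⟩ : ∃ x : EnergySpace H, H.mul (toL2 H x) = w :=
          ⟨(toL2 H).symm (H.mulInv w), H.mul_mulInv w⟩
        rw [LinearMap.mkContinuous_apply, H.mulInv_mul, ← inner_eq, inner_self_eq_norm_sq,
          inv_mul_le_iff₀ (by positivity), ← mul_pow]
        exact pow_le_pow_left₀ (norm_nonneg _) (hn x).2 2) (toL2 H y)
    refine ⟨(toL2 H).symm (H.mulInv w), (toL2 H).symm v, (mem_graph_opAH_iff H).2 ?_, ?_⟩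
    · simpa only [LinearEquiv.apply_symm_apply, H.mul_mulInv] using h
    · rw [← map_sub, LinearEquiv.symm_apply_eq]
      exact e

theorem isMDissipative_opA (hA : IsMDissipative (opAH P₁ P₀ WB H)) :
    IsMDissipative (opA P₁ P₀ WB) := by
  refine ⟨fun w z h => ?_, fun y => ?_⟩
  · have h1 := hA.re_inner_nonpos ((toL2 H).symm (H.mulInv w)) ((toL2 H).symm z)
      ((mem_graph_opAH_iff H).2 (by
        simpa only [LinearEquiv.apply_symm_apply, H.mul_mulInv] using h))
    simpa only [inner_eq, LinearEquiv.apply_symm_apply, H.mul_mulInv] using h1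
  · obtain ⟨a, ha, hn⟩ := exists_norm_le H
    obtain ⟨b, hb, hm⟩ := exists_norm_toL2_le H
    obtain ⟨C, hC, hCb⟩ := H.exists_norm_mulInv_le
    let L : EnergySpace H →ₗ[ℂ] EnergySpace H :=
      (toL2 H).symm.toLinearMap ∘ₗ H.mul ∘ₗ (toL2 H).toLinearMap
    have hL : ∀ x, toL2 H (L x) = H.mul (toL2 H x) := fun x => rfl
    -- Here `C` is multiplication by `ℋ` on the energy space: `⟨x, ℋ x⟩_ℋ = ‖ℋ x‖²`, and the energy
    -- norm of `x` is at most `a C ‖ℋ x‖`, where `C` now bounds `ℋ⁻¹`. A solution `x` yields `w = ℋ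
    -- x` with `w - A w = y`.
    obtain ⟨x, z, h, e⟩ := hA.exists_apply_sub_eq_of_coercive
      (L.mkContinuous (a * a) fun x => by
        rw [mul_assoc]
        exact (hn (L x)).1.trans (mul_le_mul_of_nonneg_left (hn x).2 ha.le))
      (c := ((a * C) ^ 2)⁻¹) (by positivity) (fun x => by
        rw [LinearMap.mkContinuous_apply, inner_eq, hL, inner_self_eq_norm_sq,
          inv_mul_le_iff₀ (by positivity), ← mul_pow]
        refine pow_le_pow_left₀ (norm_nonneg _) ((hn x).1.trans ?_) 2
        have h2 : ‖H.mulInv (H.mul (toL2 H x))‖ ≤ C * ‖H.mul (toL2 H x)‖ := hCb _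
        rw [H.mulInv_mul] at h2
        rw [mul_assoc]
        exact mul_le_mul_of_nonneg_left h2 ha.le) ((toL2 H).symm y)
    refine ⟨H.mul (toL2 H x), toL2 H z, (mem_graph_opAH_iff H).1 h, ?_⟩
    rw [LinearMap.mkContinuous_apply, LinearEquiv.eq_symm_apply, map_sub, hL] at e
    exact e

theorem generatesContractionSemigroup_opA_iff :
    GeneratesContractionSemigroup (opA P₁ P₀ WB) ↔
      GeneratesContractionSemigroup (opAH P₁ P₀ WB H) := by
  rw [generatesContractionSemigroup_iff_isMDissipative,
    generatesContractionSemigroup_iff_isMDissipative]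
  exact ⟨isMDissipative_opAH H, isMDissipative_opA H⟩

end PortHamiltonian

end

open PortHamiltonian in
/-- Let `P₁` be an invertible Hermitian `n × n` matrix, `P₀` an `n × n` matrix and `WB` an
`n × 2n` matrix. For every Hamiltonian density `ℋ`, the operator `A` generates a contraction
semigroup on `L²(0,1; ℂⁿ)` with the standard inner product if and only if `A ℋ` generates a
contraction semigroup on the energy space of `ℋ`. In particular, whether `A ℋ` generates a
contraction semigroup on its energy space does not depend on `ℋ`. -/
theorem corollary1p3 (n : ℕ) (P₁ P₀ : Matrix (Fin n) (Fin n) ℂ)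
    (WB : Matrix (Fin n) (Fin n ⊕ Fin n) ℂ)
    (hP₁ : P₁.IsHermitian) (hP₁_inv : IsUnit P₁) :
    (∀ H : HamiltonianDensity n,
      GeneratesContractionSemigroup (opA P₁ P₀ WB) ↔
        GeneratesContractionSemigroup (opAH P₁ P₀ WB H)) ∧
    (∀ H₁ H₂ : HamiltonianDensity n,
      GeneratesContractionSemigroup (opAH P₁ P₀ WB H₁) ↔
        GeneratesContractionSemigroup (opAH P₁ P₀ WB H₂)) := by
  exact ⟨fun H => generatesContractionSemigroup_opA_iff H, fun H₁ H₂ =>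
    (generatesContractionSemigroup_opA_iff H₁).symm.trans
      (generatesContractionSemigroup_opA_iff H₂)⟩
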